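/- Let $\mathcal H=\{z\in\mathbb C\mid \operatorname{Im} z>0\}$, $\log q=2\pi i z$, and let $E_2=1-24\sum_{n\ge1}\big(\sum_{d\mid n}d\big)e^{2\pi i nz}$ be the weight-$2$ Eisenstein series. For $k\in\mathbb R$ let $$D_kf=\frac{1}{2\pi i}\frac{df}{dz}-\frac{k}{12}E_2f ,\qquad D_k^{(0)}f=f,\qquad D_k^{(n)}=D_{k+2n-2}\cdots D_{k+2}D_k\quad(n\ge1).$$ A monic modular linear differential equation (monic MLDE) of weight $k$ is an equation $$D_k^{(n)}f+g_1D_k^{(n-1)}f+\cdots+g_{n-1}D_kf+g_nf=0$$ on $\mathcal H$, where $n\ge0$ and each $g_i$ is a holomorphic modular form of weight $2i$ on $\mathrm{SL}(2,\mathbb Z)$. Let $\Sigma_k$ be the set of all holomorphic functions $f:\mathcal H\to\mathbb C$ that satisfy some monic MLDE of weight $k$ (of some order $n$). Theorem. For all $k,l\in\mathbb R$: 1. $\Sigma_k\subset\Sigma_{k-1}$. 2. $(\log q)\,\Sigma_k\subset\Sigma_{k-1}$. 3. $E_2\,\Sigma_k\subset\Sigma_{k+1}$. 4. If $k-l\in\mathbb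 Z$, then $\Sigma_k+\Sigma_l\subset\Sigma_{\min\{k,l\}}$. -/

import Mathlib

open UpperHalfPlane
open scoped Manifold MatrixGroups ModularForm Pointwise

noncomputable section

/-- The iterated Ramanujan–Serre operator `D_{k+2n-2} ⋯ D_{k+2} D_k` (the identity for `n = 0`),
where `D_k f = (2πi)⁻¹ f' - (k/12) E₂ f` is Mathlib's `Derivative.serreDerivative k f`. -/
def srDiff (k : ℝ) (f : ℍ → ℂ) : ℕ → ℍ → ℂ
  | 0 => f
  | n + 1 => Derivative.serreDerivative ((k + 2 * n : ℝ) : ℂ) (srDiff k f n)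

/-- `f` satisfies some monic modular linear differential equation of weight `k`:
`∑_{i=0}^{n} g_i D_k^{(n-i)} f = 0` on the upper half plane, where `g_i` is a holomorphic modular
form of weight `2i` on `SL(2, ℤ)` and `g_0 = 1`. -/
def SatisfiesMonicMLDE (k : ℝ) (f : ℍ → ℂ) : Prop :=
  ∃ (n : ℕ) (g : ∀ i : ℕ, ModularForm 𝒮ℒ (2 * (i : ℤ))),
    (∀ z : ℍ, g 0 z = 1) ∧
    ∀ z : ℍ, ∑ i ∈ Finset.range (n + 1), g i z * srDiff k f (n - i) z = 0

/-- The set `Σ_k` of holomorphic functions on the upper half plane satisfying some monic MLDE of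
weight `k`. -/
def monicSol (k : ℝ) : Set (ℍ → ℂ) :=
  {f | MDiff f ∧ SatisfiesMonicMLDE k f}

/-- `log q = 2πi z`. -/
def logQ (z : ℍ) : ℂ := 2 * (Real.pi : ℂ) * Complex.I * (z : ℂ)

end

/-!
A holomorphic function satisfies a monic MLDE of weight `k` if and only if its iterated Serre
derivatives span a finitely generated module over the ring of modular forms of even weight. That
ring is `ℂ[E₄, E₆]`: subtracting a multiple of some `E₄ ^ a * E₆ ^ b` from a modular form leaves a
cusp form, which is divisible by the discriminant. Hence it is Noetherian, and since the Serre
derivative satisfies the Leibniz rule, solutions are closed under sums, products, with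
`Σ_k * Σ_l ⊆ Σ_{k+l}`, and Serre derivatives, `∂_k Σ_k ⊆ Σ_{k+2}`. Keeping track of the weight by
the exponent of a polynomial variable turns the operators `∂_k, ∂_{k+2}, …` into a single one, and
homogeneous components recover equations of the right weights.

If `(2πi)⁻¹ dy/dz` is constant, then `∂_1 ∂_{-1} y = (∂_1 E₂ / 12) y`, and `∂_1 E₂` is a modular
form of weight `4`. Hence `1` and `log q` lie in `Σ_{-1}`, and `E₂ = 12 ∂_{-1} 1` lies in `Σ_1`, and
all inclusions follow from the closure properties.
-/

lemma exists_eq_sum_range_smul_of_fg {R M : Type*} [Ring R] [IsNoetherianRing R] [AddCommGroup M]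
    [Module R M] {N : Submodule R M} (hN : N.FG) {v : ℕ → M} (hv : ∀ n, v n ∈ N) :
    ∃ (n : ℕ) (c : ℕ → R), v n = ∑ m ∈ Finset.range n, c m • v m := by
  have : IsNoetherian R N := isNoetherian_of_fg_of_noetherian N hN
  let w : ℕ → N := fun n ↦ ⟨v n, hv n⟩
  let F : ℕ →o Submodule R N :=
    ⟨fun n ↦ Submodule.span R (w '' Finset.range n), fun a b hab ↦
      Submodule.span_mono (Set.image_mono (by simpa using hab))⟩
  obtain ⟨n, hn⟩ := monotone_stabilizes_iff_noetherian.mpr this F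
  have hwn : w n ∈ F n := by
    rw [hn (n + 1) n.le_succ]
    exact Submodule.subset_span ⟨n, by simp, rfl⟩
  obtain ⟨c, hc⟩ := (Submodule.mem_span_image_finset_iff_exists_fun' R).mp hwn
  exact ⟨n, c, by simpa [w] using (congrArg N.subtype hc).symm⟩

section TwistedDerivation

variable {K A : Type*} [CommRing K] [CommRing A] [Algebra K A]

/-- The operator `D - k e`: a derivation `D` corrected by a multiple of the connection term `e`, in
the way the Serre derivative of weight `k` corrects `(2πi)⁻¹ d/dz` by `E₂ / 12`. -/
def twistedDeriv (D : Derivation K A A) (e : A) (k : K) : A →ₗ[K] A :=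
  D.toLinearMap - k • LinearMap.mulLeft K e

/-- The iterate `∂_{k+2n-2} ⋯ ∂_{k+2} ∂_k f`, where `∂_l = twistedDeriv D e l`; the weight goes up
by two at every step, as for modular forms. -/
def twistedIterate (D : Derivation K A A) (e : A) (k : K) (f : A) : ℕ → A
  | 0 => f
  | n + 1 => twistedDeriv D e (k + 2 * n) (twistedIterate D e k f n)

variable {D : Derivation K A A} {e : A} {k l : K} {p q : A}

lemma twistedDeriv_apply (k : K) (p : A) : twistedDeriv D e k p = D p - k • (e * p) := rfl

lemma twistedDeriv_mul (k l : K) (p q : A) :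
    twistedDeriv D e (k + l) (p * q) = twistedDeriv D e k p * q + p * twistedDeriv D e l q := by
  simp only [twistedDeriv_apply, Derivation.leibniz, smul_eq_mul, Algebra.smul_def, map_add]
  ring

variable {S : Subalgebra K A}

lemma twistedDeriv_mem_span (hS : ∀ s ∈ S, D s ∈ S) {t : Set A}
    (ht : ∀ x ∈ t, twistedDeriv D e k x ∈ Submodule.span S t) {x : A}
    (hx : x ∈ Submodule.span S t) : twistedDeriv D e k x ∈ Submodule.span S t := by
  induction hx using Submodule.span_induction with
  | mem x hx => exact ht x hx
  | zero => simp
  | add x y _ _ hx hy => rw [map_add]; exact add_mem hx hy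
  | smul s x hx ih =>
    have leibniz : twistedDeriv D e k (s • x) =
        (⟨D s, hS s s.2⟩ : S) • x + s • twistedDeriv D e k x := by
      have := twistedDeriv_mul (D := D) (e := e) 0 k (s : A) x
      rwa [zero_add, twistedDeriv_apply 0, zero_smul, sub_zero] at this
    rw [leibniz]
    exact add_mem (Submodule.smul_mem _ _ hx) (Submodule.smul_mem _ _ ih)

/-- The analogue, for the operator `D - k e` and the coefficient ring `S`, of a D-finite (holonomic)
function: `p` lies in a finitely generated `S`-module stable under the operator. -/
def IsDFinite (D : Derivation K A A) (e : A) (S : Subalgebra K A) (k : K) (p : A) : Prop :=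
  ∃ N : Submodule S A, N.FG ∧ p ∈ N ∧ Set.MapsTo (twistedDeriv D e k) N N

lemma IsDFinite.add (hp : IsDFinite D e S k p) (hq : IsDFinite D e S k q) :
    IsDFinite D e S k (p + q) := by
  obtain ⟨N, hN, hpN, hN'⟩ := hp
  obtain ⟨M, hM, hqM, hM'⟩ := hq
  refine ⟨N ⊔ M, hN.sup hM, Submodule.add_mem_sup hpN hqM, fun x hx ↦ ?_⟩
  obtain ⟨y, hy, z, hz, rfl⟩ := Submodule.mem_sup.mp hx
  rw [map_add]
  exact Submodule.add_mem_sup (hN' hy) (hM' hz)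

lemma IsDFinite.mul (hp : IsDFinite D e S k p) (hq : IsDFinite D e S l q) :
    IsDFinite D e S (k + l) (p * q) := by
  obtain ⟨N, hN, hpN, hN'⟩ := hp
  obtain ⟨M, hM, hqM, hM'⟩ := hq
  refine ⟨N * M, hN.mul hM, Submodule.mul_mem_mul hpN hqM, fun x hx ↦ ?_⟩
  induction hx using Submodule.mul_induction_on' with
  | mem_mul_mem y hy z hz =>
    rw [twistedDeriv_mul]
    exact add_mem (Submodule.mul_mem_mul (hN' hy) hz) (Submodule.mul_mem_mul hy (hM' hz))
  | add y _ z _ hy hz => rw [map_add]; exact add_mem hy hz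

lemma IsDFinite.twistedDeriv (hp : IsDFinite D e S k p) :
    IsDFinite D e S k (twistedDeriv D e k p) := by
  obtain ⟨N, hN, hpN, hN'⟩ := hp
  exact ⟨N, hN, hN' hpN, hN'⟩

lemma isDFinite_of_iterate_eq_sum (hS : ∀ s ∈ S, D s ∈ S) {n : ℕ} {c : ℕ → S}
    (h : (twistedDeriv D e k)^[n] p = ∑ m ∈ Finset.range n, c m • (twistedDeriv D e k)^[m] p) :
    IsDFinite D e S k p := by
  let v : ℕ → A := fun m ↦ (twistedDeriv D e k)^[m] p
  let N : Submodule S A := Submodule.span S (v '' Finset.range n)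
  have mem_of_lt : ∀ m < n, v m ∈ N := fun m hm ↦ Submodule.subset_span ⟨m, by simpa, rfl⟩
  have mem_n : v n ∈ N := by
    rw [show v n = _ from h]
    exact sum_mem fun m hm ↦ N.smul_mem _ (mem_of_lt m (Finset.mem_range.mp hm))
  have mem_of_le : ∀ m ≤ n, v m ∈ N := fun m hm ↦
    hm.lt_or_eq.elim (mem_of_lt m) fun hm ↦ hm ▸ mem_n
  refine ⟨N, Submodule.fg_span (Set.toFinite _), mem_of_le 0 n.zero_le,
    fun x hx ↦ twistedDeriv_mem_span hS ?_ hx⟩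
  rintro _ ⟨m, hm, rfl⟩
  have shift : twistedDeriv D e k (v m) = v (m + 1) := (Function.iterate_succ_apply' _ _ _).symm
  exact shift ▸ mem_of_le (m + 1) (by simpa using hm)

lemma isDFinite_iff_exists_iterate_eq_sum [IsNoetherianRing S] (hS : ∀ s ∈ S, D s ∈ S) :
    IsDFinite D e S k p ↔ ∃ (n : ℕ) (c : ℕ → S),
      (twistedDeriv D e k)^[n] p = ∑ m ∈ Finset.range n, c m • (twistedDeriv D e k)^[m] p :=
  ⟨fun ⟨_, hN, hpN, hN'⟩ ↦ exists_eq_sum_range_smul_of_fg hN fun n ↦ hN'.iterate n hpN,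
    fun ⟨_, _, h⟩ ↦ isDFinite_of_iterate_eq_sum hS h⟩

end TwistedDerivation

section MonicEquation

open Polynomial

variable {K A : Type*} [CommRing K] [CommRing A] [Algebra K A]

/-- The subalgebra of `A[X]` of the polynomials whose coefficient of `X ^ i` has degree `i`, the
polynomial model of the graded algebra `⨁ i, 𝒜 i`; compare `reesAlgebra`. -/
def gradedSubalgebra (𝒜 : ℕ → Submodule K A) [SetLike.GradedMonoid 𝒜] : Subalgebra K A[X] where
  carrier := {p | ∀ i, p.coeff i ∈ 𝒜 i}
  add_mem' hp hq i := by
    rw [coeff_add]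
    exact add_mem (hp i) (hq i)
  mul_mem' hp hq i := by
    rw [coeff_mul]
    refine sum_mem fun x hx ↦ ?_
    rw [← Finset.HasAntidiagonal.mem_antidiagonal.mp hx]
    exact SetLike.mul_mem_graded (hp x.1) (hq x.2)
  algebraMap_mem' c i := by
    rw [Polynomial.algebraMap_apply, coeff_C]
    split_ifs with hi
    · rw [hi, Algebra.algebraMap_eq_smul_one]
      exact Submodule.smul_mem _ c SetLike.GradedOne.one_mem
    · exact zero_mem _

/-- The derivation of `A[X]` acting on the coefficient of `X ^ n` as
`∂_{2n} = twistedDeriv D e (2n)` and raising the degree by one, so that the exponent of `X` records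
half the weight. -/
noncomputable def weightedDeriv (D : Derivation K A A) (e : A) : Derivation K A[X] A[X] :=
  (X : A[X]) • PolynomialModule.equivPolynomialSelf.compDer D.mapCoeffs -
    (monomial 2 (2 * e) : A[X]) • (Polynomial.derivative' (R := A)).restrictScalars K

variable {𝒜 : ℕ → Submodule K A} [SetLike.GradedMonoid 𝒜] {D : Derivation K A A}
  {e f g : A} {k l : K}

lemma monomial_mem_gradedSubalgebra {n : ℕ} {a : A} (ha : a ∈ 𝒜 n) :
    monomial n a ∈ gradedSubalgebra 𝒜 := by
  intro i
  rw [coeff_monomial]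
  split_ifs with h
  · exact h ▸ ha
  · exact zero_mem _

lemma weightedDeriv_monomial (n : ℕ) (a : A) :
    weightedDeriv D e (monomial n a) = monomial (n + 1) (twistedDeriv D e (2 * n) a) := by
  have expand : weightedDeriv D e (monomial n a) =
      X * PolynomialModule.equivPolynomialSelf (D.mapCoeffs (monomial n a)) -
        monomial 2 (2 * e) * derivative (monomial n a) := rfl
  rw [expand, Derivation.mapCoeffs_monomial, PolynomialModule.equivPolynomialSelf_apply_eq,
    PolynomialModule.equivPolynomial_single, derivative_monomial, X_mul_monomial,
    monomial_mul_monomial, twistedDeriv_apply, map_sub]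
  cases n with
  | zero => simp
  | succ n =>
    congr 2
    · lia
    · rw [Algebra.smul_def]
      simp only [map_mul, map_ofNat, map_natCast]
      push_cast
      ring

lemma twistedDeriv_weightedDeriv_monomial (k : K) (n : ℕ) (a : A) :
    twistedDeriv (weightedDeriv D e) (monomial 1 e) k (monomial n a) =
      monomial (n + 1) (twistedDeriv D e (k + 2 * n) a) := by
  rw [twistedDeriv_apply, weightedDeriv_monomial, monomial_mul_monomial, smul_monomial,
    add_comm 1 n, ← map_sub, twistedDeriv_apply, twistedDeriv_apply, sub_sub, ← add_smul,
    add_comm k]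

lemma iterate_twistedDeriv_weightedDeriv_monomial (k : K) (a n : ℕ) (f : A) :
    (twistedDeriv (weightedDeriv D e) (monomial 1 e) k)^[n] (monomial a f) =
      monomial (n + a) (twistedIterate D e (k + 2 * a) f n) := by
  induction n with
  | zero => simp [twistedIterate]
  | succ n ih =>
    rw [Function.iterate_succ_apply', ih, twistedDeriv_weightedDeriv_monomial, twistedIterate,
      add_right_comm n a 1]
    push_cast
    congr 3
    ring

lemma weightedDeriv_mem_gradedSubalgebra
    (hD : ∀ i, ∀ a ∈ 𝒜 i, twistedDeriv D e (2 * i : K) a ∈ 𝒜 (i + 1)) :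
    ∀ p ∈ gradedSubalgebra 𝒜, weightedDeriv D e p ∈ gradedSubalgebra 𝒜 := by
  intro p hp
  rw [p.as_sum_range, map_sum]
  refine sum_mem fun i _ ↦ ?_
  rw [weightedDeriv_monomial]
  exact monomial_mem_gradedSubalgebra (hD i _ (hp i))

/-- `f` satisfies an abstract monic modular differential equation
`∂^n f + g₁ ∂^{n-1} f + ⋯ + g_n f = 0`, where `∂^j f = twistedIterate D e k f j` and `g_i` lies in
the piece `𝒜 i` of degree `i`, which corresponds to the weight `2i`. -/
def SatisfiesMonicEquation (𝒜 : ℕ → Submodule K A) (D : Derivation K A A) (e : A) (k : K) (f : A) :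
    Prop :=
  ∃ (n : ℕ) (g : ℕ → A), (∀ i, g i ∈ 𝒜 i) ∧ g 0 = 1 ∧
    ∑ i ∈ Finset.range (n + 1), g i * twistedIterate D e k f (n - i) = 0

lemma satisfiesMonicEquation_iff_exists_twistedIterate_eq_sum :
    SatisfiesMonicEquation 𝒜 D e k f ↔ ∃ (n : ℕ) (c : ℕ → A), (∀ i, c i ∈ 𝒜 (i + 1)) ∧
      twistedIterate D e k f n =
        ∑ i ∈ Finset.range n, c i * twistedIterate D e k f (n - (i + 1)) := by
  constructor
  · rintro ⟨n, g, hg, hg0, h⟩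
    refine ⟨n, fun i ↦ -g (i + 1), fun i ↦ neg_mem (hg _), ?_⟩
    rw [Finset.sum_range_succ', hg0, one_mul, Nat.sub_zero] at h
    simpa using eq_neg_of_add_eq_zero_right h
  · rintro ⟨n, c, hc, h⟩
    refine ⟨n, fun | 0 => 1 | i + 1 => -c i,
      fun | 0 => SetLike.GradedOne.one_mem | i + 1 => neg_mem (hc i), rfl, ?_⟩
    rw [Finset.sum_range_succ', Nat.sub_zero, h]
    simp

/-- The equation is the homogeneous part, of degree `n + a`, of a relation over the graded ring
expressing the `n`-th iterate through the previous ones. -/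
lemma isDFinite_monomial_iff [IsNoetherianRing (gradedSubalgebra 𝒜)]
    (hD : ∀ i, ∀ a ∈ 𝒜 i, twistedDeriv D e (2 * i : K) a ∈ 𝒜 (i + 1)) (a : ℕ) :
    IsDFinite (weightedDeriv D e) (monomial 1 e) (gradedSubalgebra 𝒜) k (monomial a f) ↔
      SatisfiesMonicEquation 𝒜 D e (k + 2 * a) f := by
  rw [isDFinite_iff_exists_iterate_eq_sum (weightedDeriv_mem_gradedSubalgebra hD),
    satisfiesMonicEquation_iff_exists_twistedIterate_eq_sum]
  simp only [iterate_twistedDeriv_weightedDeriv_monomial, Subalgebra.smul_def, smul_eq_mul]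
  constructor
  · rintro ⟨n, c, h⟩
    refine ⟨n, fun i ↦ (c (n - 1 - i) : A[X]).coeff (i + 1), fun i ↦ (c _).2 _, ?_⟩
    have coeff_eq := congrArg (fun p ↦ p.coeff (n + a)) h
    rw [← Finset.sum_range_reflect] at coeff_eq
    simp only [coeff_monomial_same, finsetSum_coeff] at coeff_eq
    rw [coeff_eq]
    refine Finset.sum_congr rfl fun i hi ↦ ?_
    have hi' := Finset.mem_range.mp hi
    rw [show n + a = (i + 1) + (n - 1 - i + a) by lia, coeff_mul_monomial,
      show n - (i + 1) = n - 1 - i by lia]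
  · rintro ⟨n, c, hc, h⟩
    refine ⟨n, fun m ↦ ⟨monomial _ (c (n - 1 - m)), monomial_mem_gradedSubalgebra (hc _)⟩, ?_⟩
    rw [h, map_sum, ← Finset.sum_range_reflect]
    refine Finset.sum_congr rfl fun m hm ↦ ?_
    have hm' := Finset.mem_range.mp hm
    rw [monomial_mul_monomial, show n - (n - 1 - m + 1) = m by lia,
      show n - 1 - m + 1 + (m + a) = n + a by lia]

lemma twistedDeriv_one_twistedDeriv_neg_one {y : A} {c : K} (hy : D y = algebraMap K A c) :
    twistedDeriv D e 1 (twistedDeriv D e (-1 : K) y) = twistedDeriv D e (1 : K) e * y := by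
  have first : twistedDeriv D e (-1 : K) y = algebraMap K A c + e * y := by
    simp [twistedDeriv_apply, hy]
  rw [first]
  simp only [twistedDeriv_apply, one_smul, map_add, Derivation.map_algebraMap, Derivation.leibniz,
    hy, smul_eq_mul]
  ring

lemma satisfiesMonicEquation_neg_one (he : twistedDeriv D e (1 : K) e ∈ 𝒜 2) {y : A} {c : K}
    (hy : D y = algebraMap K A c) : SatisfiesMonicEquation 𝒜 D e (-1 : K) y := by
  refine ⟨2, fun | 0 => 1 | 2 => -twistedDeriv D e (1 : K) e | _ => 0,
    fun | 0 => SetLike.GradedOne.one_mem | 1 => zero_mem _ | 2 => neg_mem he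
        | _ + 3 => zero_mem _, rfl, ?_⟩
  have iterate_two :
      twistedIterate D e (-1 : K) y 2 = twistedDeriv D e 1 (twistedDeriv D e (-1 : K) y) := by
    simp only [twistedIterate]
    norm_num
  simp [Finset.sum_range_succ, iterate_two, twistedDeriv_one_twistedDeriv_neg_one hy,
    twistedIterate]

section Closure

variable [IsNoetherianRing (gradedSubalgebra 𝒜)]
  (hD : ∀ i, ∀ a ∈ 𝒜 i, twistedDeriv D e (2 * i : K) a ∈ 𝒜 (i + 1))

include hD

lemma isDFinite_C_iff : IsDFinite (weightedDeriv D e) (monomial 1 e) (gradedSubalgebra 𝒜) k (C f) ↔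
    SatisfiesMonicEquation 𝒜 D e k f := by
  simpa using isDFinite_monomial_iff (f := f) (k := k) hD 0

lemma SatisfiesMonicEquation.add (hf : SatisfiesMonicEquation 𝒜 D e k f)
    (hg : SatisfiesMonicEquation 𝒜 D e k g) : SatisfiesMonicEquation 𝒜 D e k (f + g) := by
  rw [← isDFinite_C_iff hD] at hf hg ⊢
  rw [C_add]
  exact hf.add hg

lemma SatisfiesMonicEquation.mul (hf : SatisfiesMonicEquation 𝒜 D e k f)
    (hg : SatisfiesMonicEquation 𝒜 D e l g) : SatisfiesMonicEquation 𝒜 D e (k + l) (f * g) := by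
  rw [← isDFinite_C_iff hD] at hf hg ⊢
  rw [C_mul]
  exact hf.mul hg

lemma SatisfiesMonicEquation.twistedDeriv (hf : SatisfiesMonicEquation 𝒜 D e k f) :
    SatisfiesMonicEquation 𝒜 D e (k + 2) (twistedDeriv D e k f) := by
  rw [← isDFinite_C_iff hD] at hf
  have := hf.twistedDeriv
  rw [← monomial_zero_left, twistedDeriv_weightedDeriv_monomial, isDFinite_monomial_iff hD] at this
  simpa using this

lemma satisfiesMonicEquation_smul_connection (he : twistedDeriv D e (1 : K) e ∈ 𝒜 2) (c : K) :
    SatisfiesMonicEquation 𝒜 D e (1 : K) (c • e) := by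
  have hc : SatisfiesMonicEquation 𝒜 D e (-1 : K) (algebraMap K A c) :=
    satisfiesMonicEquation_neg_one he (c := 0) (by simp)
  have eq_smul : twistedDeriv D e (-1 : K) (algebraMap K A c) = c • e := by
    simp [twistedDeriv_apply, Algebra.smul_def, mul_comm]
  have := hc.twistedDeriv hD
  rwa [eq_smul, show (-1 + 2 : K) = 1 by ring] at this

end Closure

end MonicEquation

section ModularForms

open ModularForm EisensteinSeries Derivative

/-- The modular form given by a holomorphic function which is bounded at `i∞` and invariant under
`SL(2, ℤ)`; invariance moves the boundedness to the other cusps. -/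
noncomputable def modularFormOfSlashInvariant {k : ℤ} (F : ℍ → ℂ) (hF : MDiff F)
    (hinv : ∀ γ : SL(2, ℤ), F ∣[k] γ = F) (hbdd : IsBoundedAtImInfty F) : ModularForm 𝒮ℒ k where
  toFun := F
  slash_action_eq' := fun _ ⟨γ, hγ⟩ ↦ hγ ▸ hinv γ
  holo' := hF
  bdd_at_cusps' {c} hc := by
    rw [Subgroup.IsArithmetic.isCusp_iff_isCusp_SL2Z] at hc
    rw [OnePoint.isBoundedAt_iff_forall_SL2Z hc]
    intro γ _
    rwa [hinv]

/-- The Cauchy estimate on the unit disc around `z` bounds the derivative at `z`. -/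
lemma isBoundedAtImInfty_normalizedDerivOfComplex {F : ℍ → ℂ} (hF : MDiff F)
    (hbdd : IsBoundedAtImInfty F) : IsBoundedAtImInfty (normalizedDerivOfComplex F) := by
  rw [isBoundedAtImInfty_iff] at hbdd ⊢
  obtain ⟨M, A, hMA⟩ := hbdd
  refine ⟨‖(2 * Real.pi * Complex.I : ℂ)⁻¹‖ * (M / 1), max A 0 + 2, fun z hz ↦ ?_⟩
  have im_ge : ∀ w ∈ Metric.closedBall (z : ℂ) 1, max A 0 + 1 ≤ w.im := by
    intro w hw
    have him : |(w - z).im| ≤ 1 :=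
      (Complex.abs_im_le_norm _).trans (by simpa [dist_eq_norm] using hw)
    rw [Complex.sub_im, coe_im] at him
    linarith [(abs_le.mp him).1]
  have im_pos : ∀ w ∈ Metric.closedBall (z : ℂ) 1, 0 < w.im := fun w hw ↦
    lt_of_lt_of_le (by positivity) (im_ge w hw)
  rw [normalizedDerivOfComplex, norm_mul]
  refine mul_le_mul_of_nonneg_left ?_ (norm_nonneg _)
  rw [UpperHalfPlane.mdifferentiable_iff] at hF
  refine Complex.norm_deriv_le_of_forall_mem_sphere_norm_le one_pos
    (DifferentiableOn.diffContOnCl (hF.mono ?_)) fun w hw ↦ ?_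
  · rwa [closure_ball _ one_ne_zero]
  · have hw' := Metric.sphere_subset_closedBall hw
    rw [Function.comp_apply, ofComplex_apply_of_im_pos (im_pos w hw')]
    exact hMA _ (le_trans (by linarith [le_max_left A 0]) (im_ge w hw'))

lemma isBoundedAtImInfty_serreDerivative (k : ℂ) {F : ℍ → ℂ} (hF : MDiff F)
    (hbdd : IsBoundedAtImInfty F) : IsBoundedAtImInfty (serreDerivative k F) := by
  have eq_sub : serreDerivative k F =
      normalizedDerivOfComplex F - (fun _ ↦ k * 12⁻¹) * (E2 * F) := by
    ext z
    simp [mul_assoc]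
  rw [eq_sub]
  exact (isBoundedAtImInfty_normalizedDerivOfComplex hF hbdd).sub
    ((Filter.const_boundedAtFilter _ _).mul (isBoundedAtImInfty_E2.mul hbdd))

/-- The Serre derivative of weight `k` of a modular form of weight `k`. -/
noncomputable def serreDerivativeForm {k : ℤ} (f : ModularForm 𝒮ℒ k) : ModularForm 𝒮ℒ (k + 2) :=
  modularFormOfSlashInvariant (serreDerivative k f) (serreDerivative_mdifferentiable _ f.holo')
    (fun γ ↦ serreDerivative_slash_invariant f.holo' (f.slash_action_eq' _ ⟨γ, rfl⟩))
    (isBoundedAtImInfty_serreDerivative _ f.holo' <| by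
      simpa using ModularFormClass.bdd_at_infty_slash f (1 : SL(2, ℤ)))

/-- The logarithmic derivative `(2πi)⁻¹ c / (c z + d)` of the automorphy factor of `γ`, the cocycle
which measures how far `E₂` is from being modular. -/
noncomputable def logDerivDenom (γ : SL(2, ℤ)) (z : ℍ) : ℂ :=
  (2 * Real.pi * Complex.I)⁻¹ * (γ 1 0 / denom γ z)

variable (γ : SL(2, ℤ))

lemma hasDerivAt_logDerivDenom (z : ℍ) : HasDerivAt (logDerivDenom γ ∘ ofComplex)
    (-(2 * Real.pi * Complex.I) * logDerivDenom γ z ^ 2) z := by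
  have hderiv := (hasDerivAt_denom_zpow (γ : GL (Fin 2) ℝ) (-1) z).const_mul
    ((2 * Real.pi * Complex.I)⁻¹ * (γ 1 0 : ℂ))
  refine (hderiv.congr_of_eventuallyEq ?_).congr_deriv ?_
  · filter_upwards [isOpen_upperHalfPlaneSet.mem_nhds z.im_pos] with w hw
    simp [logDerivDenom, ofComplex_apply_of_im_pos hw, div_eq_mul_inv, mul_assoc]
  · have hdenom := denom_ne_zero γ z
    rw [logDerivDenom, zpow_sub₀ hdenom, zpow_neg_one, zpow_one]
    push_cast
    field_simp
    simp [sq]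

lemma mdifferentiable_logDerivDenom : MDiff (logDerivDenom γ) := by
  rw [UpperHalfPlane.mdifferentiable_iff]
  exact fun w hw ↦
    (hasDerivAt_logDerivDenom γ ⟨w, hw⟩).differentiableAt.differentiableWithinAt

lemma normalizedDerivOfComplex_logDerivDenom :
    normalizedDerivOfComplex (logDerivDenom γ) = -logDerivDenom γ ^ 2 := by
  ext z
  rw [normalizedDerivOfComplex, (hasDerivAt_logDerivDenom γ z).deriv]
  simp only [Pi.neg_apply, Pi.pow_apply]
  field_simp

lemma E2_slash : E2 ∣[(2 : ℤ)] γ = E2 + (12 : ℂ) • logDerivDenom γ := by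
  rw [E2_slash_action]
  ext z
  simp only [Pi.sub_apply, Pi.add_apply, Pi.smul_apply, smul_eq_mul, D2, logDerivDenom,
    riemannZeta_two]
  field_simp
  linear_combination (-12 * (γ 1 0 : ℂ)) * Complex.I_sq

lemma serreDerivative_one_E2_slash :
    serreDerivative 1 E2 ∣[(4 : ℤ)] γ = serreDerivative 1 E2 := by
  have eq_sub : serreDerivative 1 E2 =
      normalizedDerivOfComplex E2 - (12⁻¹ : ℂ) • (E2 * E2) := by
    ext z
    simp [mul_assoc]
  have deriv_slash := normalizedDerivOfComplex_SL_slash (k := 2) (γ := γ) E2_mdifferentiable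
  have sq_slash := mul_slash_SL2 2 2 γ E2 E2
  norm_num only at deriv_slash sq_slash
  have hmdiff := mdifferentiable_logDerivDenom γ
  rw [E2_slash, normalizedDerivOfComplex_add _ _ E2_mdifferentiable (hmdiff.const_smul _),
    normalizedDerivOfComplex_smul _ _ hmdiff, normalizedDerivOfComplex_logDerivDenom]
    at deriv_slash
  rw [eq_sub, sub_eq_add_neg, SlashAction.add_slash, SlashAction.neg_slash,
    ModularForm.SL_smul_slash, sq_slash, E2_slash]
  ext z
  have deriv_slash_apply : normalizedDerivOfComplex E2 z + 12 * -logDerivDenom γ z ^ 2 =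
      (normalizedDerivOfComplex E2 ∣[(4 : ℤ)] γ) z -
        2 * (logDerivDenom γ z * (E2 z + 12 * logDerivDenom γ z)) := by
    simpa only [Pi.add_apply, Pi.sub_apply, Pi.smul_apply, Pi.neg_apply, Pi.pow_apply, smul_eq_mul,
      logDerivDenom, mul_assoc] using congrFun deriv_slash z
  simp only [Pi.smul_apply, smul_eq_mul, Pi.add_apply, Pi.neg_apply, Pi.mul_apply]
  linear_combination -deriv_slash_apply

/-- `∂₁ E₂ = D E₂ - E₂² / 12`, a modular form although `E₂` is not one; by Ramanujan's identity it
is `-E₄ / 12`. -/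
noncomputable def serreDerivativeE2 : ModularForm 𝒮ℒ 4 :=
  modularFormOfSlashInvariant (serreDerivative 1 E2)
    (serreDerivative_mdifferentiable _ E2_mdifferentiable) serreDerivative_one_E2_slash
    (isBoundedAtImInfty_serreDerivative _ E2_mdifferentiable isBoundedAtImInfty_E2)

lemma exists_eq_smul_add_discriminant_mul {k : ℤ} (f P : ModularForm 𝒮ℒ k)
    (hP : (qExpansion 1 P).coeff 0 = 1) :
    ∃ (c : ℂ) (g : ModularForm 𝒮ℒ (k - 12)), (f : ℍ → ℂ) = c • ⇑P + discriminant * g := by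
  obtain ⟨h, hh⟩ := sub_smul_isCuspForm f P hP
  refine ⟨(qExpansion 1 f).coeff 0, CuspForm.discriminantEquiv h, ?_⟩
  have coe_eq : (h : ℍ → ℂ) = ⇑f - (qExpansion 1 f).coeff 0 • ⇑P := congrArg DFunLike.coe hh
  rw [discriminant_mul_discriminantEquiv, coe_eq, add_sub_cancel]

lemma qExpansion_E₄_pow_mul_E₆_pow_coeff_zero (a b : ℕ) :
    (qExpansion 1 ((E₄.pow a).mul (E₆.pow b))).coeff 0 = 1 := by
  have h4 := E_qExpansion_coeff_zero (by norm_num : 3 ≤ 4) ⟨2, rfl⟩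
  have h6 := E_qExpansion_coeff_zero (by norm_num : 3 ≤ 6) ⟨3, rfl⟩
  rw [PowerSeries.coeff_zero_eq_constantCoeff_apply] at h4 h6 ⊢
  rw [ModularForm.qExpansion_mul one_pos one_mem_strictPeriods_SL,
    ModularForm.qExpansion_pow one_pos one_mem_strictPeriods_SL,
    ModularForm.qExpansion_pow one_pos one_mem_strictPeriods_SL, map_mul, map_pow, map_pow, h4, h6]
  simp

end ModularForms

section HolomorphicFunctions

open ModularForm EisensteinSeries Derivative Polynomial

/-- The algebra of holomorphic functions on the upper half plane. -/
def holomorphicFunctions : Subalgebra ℂ (ℍ → ℂ) where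
  carrier := {f | MDiff f}
  mul_mem' hf hg := hf.mul hg
  add_mem' hf hg := hf.add hg
  algebraMap_mem' _ := mdifferentiable_const

/-- The derivation `(2πi)⁻¹ d/dz` of the algebra of holomorphic functions. -/
noncomputable def holomorphicDeriv : Derivation ℂ holomorphicFunctions holomorphicFunctions :=
  Derivation.mk'
    { toFun := fun F ↦
        ⟨normalizedDerivOfComplex F, normalizedDerivOfComplex_mdifferentiable F.2⟩
      map_add' := fun F G ↦ Subtype.ext (normalizedDerivOfComplex_add _ _ F.2 G.2)
      map_smul' := fun c F ↦ Subtype.ext (normalizedDerivOfComplex_smul c _ F.2) }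
    fun F G ↦ Subtype.ext <| by
      refine (normalizedDerivOfComplex_mul _ _ F.2 G.2).trans ?_
      rw [add_comm, mul_comm _ (G : ℍ → ℂ)]
      rfl

/-- The connection term `E₂ / 12` of the Serre derivative. -/
noncomputable def serreConnection : holomorphicFunctions :=
  (12⁻¹ : ℂ) • ⟨E2, E2_mdifferentiable⟩

lemma coe_twistedDeriv (k : ℂ) (F : holomorphicFunctions) :
    (twistedDeriv holomorphicDeriv serreConnection k F : ℍ → ℂ) = serreDerivative k F := by
  ext z
  change normalizedDerivOfComplex F z - k * (12⁻¹ * E2 z * F.1 z) = _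
  rw [serreDerivative_apply]
  ring

/-- A modular form as a holomorphic function. -/
def toHolomorphic (k : ℤ) : ModularForm 𝒮ℒ k →ₗ[ℂ] holomorphicFunctions where
  toFun f := ⟨f, f.holo'⟩
  map_add' _ _ := rfl
  map_smul' _ _ := rfl

/-- The modular forms of weight `2n`, as the piece of degree `n` of a graded algebra of holomorphic
functions. -/
def modularGrade (n : ℕ) : Submodule ℂ holomorphicFunctions :=
  LinearMap.range (toHolomorphic (2 * n))

lemma toHolomorphic_mem_modularGrade {k : ℤ} {n : ℕ} (hk : k = 2 * n) (f : ModularForm 𝒮ℒ k) :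
    toHolomorphic k f ∈ modularGrade n :=
  ⟨f.mcast hk, rfl⟩

instance : SetLike.GradedMonoid modularGrade where
  one_mem := toHolomorphic_mem_modularGrade (by simp) (1 : ModularForm 𝒮ℒ 0)
  mul_mem := by
    rintro m n _ _ ⟨f, rfl⟩ ⟨g, rfl⟩
    exact toHolomorphic_mem_modularGrade (by push_cast; ring) (f.mul g)

lemma twistedDeriv_mem_modularGrade (n : ℕ) :
    ∀ F ∈ modularGrade n,
      twistedDeriv holomorphicDeriv serreConnection (2 * n : ℂ) F ∈ modularGrade (n + 1) := by
  rintro _ ⟨f, rfl⟩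
  convert toHolomorphic_mem_modularGrade (n := n + 1) (by push_cast; ring) (serreDerivativeForm f)
  refine Subtype.ext ((coe_twistedDeriv _ _).trans ?_)
  change _ = serreDerivative _ _
  push_cast
  rfl

lemma twistedDeriv_serreConnection_mem_modularGrade :
    twistedDeriv holomorphicDeriv serreConnection (1 : ℂ) serreConnection ∈ modularGrade 2 := by
  convert toHolomorphic_mem_modularGrade (n := 2) rfl ((12⁻¹ : ℂ) • serreDerivativeE2)
  refine Subtype.ext ?_
  conv_lhs => rw [serreConnection, map_smul]
  exact congrArg ((12⁻¹ : ℂ) • ·) (coe_twistedDeriv 1 ⟨E2, E2_mdifferentiable⟩)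

lemma exists_toHolomorphic_eq_add {k : ℤ} {a b : ℕ} (hk : k = 4 * a + 6 * b)
    (f : ModularForm 𝒮ℒ k) : ∃ (c : ℂ) (g : ModularForm 𝒮ℒ (k - 12)),
      toHolomorphic k f = c • (toHolomorphic 4 E₄ ^ a * toHolomorphic 6 E₆ ^ b) +
        (1728⁻¹ : ℂ) • ((toHolomorphic 4 E₄ ^ 3 - toHolomorphic 6 E₆ ^ 2) *
          toHolomorphic (k - 12) g) := by
  obtain ⟨c, g, hg⟩ := exists_eq_smul_add_discriminant_mul f
    (((E₄.pow a).mul (E₆.pow b)).mcast (by rw [hk]; ring))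
    (qExpansion_E₄_pow_mul_E₆_pow_coeff_zero a b)
  refine ⟨c, g, Subtype.ext (hg.trans ?_)⟩
  ext z
  simp only [toHolomorphic, LinearMap.coe_mk, AddHom.coe_mk, AddMemClass.coe_add, SetLike.val_smul,
    MulMemClass.coe_mul, SubmonoidClass.coe_pow, AddSubgroupClass.coe_sub, coe_mcast,
    ModularForm.coe_mul, ModularForm.coe_pow, Pi.add_apply, Pi.sub_apply, Pi.smul_apply,
    Pi.mul_apply, Pi.pow_apply, smul_eq_mul, discriminant_eq_E₄_cube_sub_E₆_sq]
  ring

/-- The algebra generated by `E₄` and `E₆`, placed in the degrees equal to half their weights; it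
turns out to be the graded algebra of all modular forms of even weight. -/
noncomputable def eisensteinSubalgebra : Subalgebra ℂ holomorphicFunctions[X] :=
  Algebra.adjoin ℂ {monomial 2 (toHolomorphic 4 E₄), monomial 3 (toHolomorphic 6 E₆)}

lemma monomial_E₄_mem_eisensteinSubalgebra :
    monomial 2 (toHolomorphic 4 E₄) ∈ eisensteinSubalgebra :=
  Algebra.subset_adjoin (Set.mem_insert _ _)

lemma monomial_E₆_mem_eisensteinSubalgebra :
    monomial 3 (toHolomorphic 6 E₆) ∈ eisensteinSubalgebra :=
  Algebra.subset_adjoin (Set.mem_insert_of_mem _ rfl)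

lemma monomial_E₄_pow_mul_E₆_pow_mem_eisensteinSubalgebra (a b : ℕ) :
    monomial (2 * a + 3 * b) (toHolomorphic 4 E₄ ^ a * toHolomorphic 6 E₆ ^ b) ∈
      eisensteinSubalgebra := by
  rw [← monomial_mul_monomial, ← monomial_pow, ← monomial_pow]
  exact mul_mem (pow_mem monomial_E₄_mem_eisensteinSubalgebra a)
    (pow_mem monomial_E₆_mem_eisensteinSubalgebra b)

lemma monomial_E₄_cube_sub_E₆_sq_mem_eisensteinSubalgebra :
    monomial 6 (toHolomorphic 4 E₄ ^ 3 - toHolomorphic 6 E₆ ^ 2) ∈ eisensteinSubalgebra := by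
  rw [sub_eq_add_neg, ← neg_one_smul ℂ, map_add, ← smul_monomial]
  refine add_mem ?_ (Subalgebra.smul_mem _ ?_ _)
  · simpa using monomial_E₄_pow_mul_E₆_pow_mem_eisensteinSubalgebra 3 0
  · simpa using monomial_E₄_pow_mul_E₆_pow_mem_eisensteinSubalgebra 0 2

lemma monomial_zero_mem_eisensteinSubalgebra {F : holomorphicFunctions} (hF : F ∈ modularGrade 0) :
    monomial 0 F ∈ eisensteinSubalgebra := by
  obtain ⟨f, rfl⟩ := hF
  obtain ⟨c, hc⟩ := ModularFormClass.levelOne_weight_zero_const (f.mcast (by simp))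
  have eq_const : toHolomorphic _ f = algebraMap ℂ holomorphicFunctions c := Subtype.ext hc
  rw [eq_const]
  exact Subalgebra.algebraMap_mem _ c

lemma modularGrade_one : modularGrade 1 = ⊥ := by
  refine eq_bot_iff.mpr ?_
  rintro _ ⟨f, rfl⟩
  rw [Submodule.mem_bot, rank_zero_iff_forall_zero.mp levelOne_weight_two_rank_zero f, map_zero]

lemma monomial_mem_eisensteinSubalgebra {n : ℕ} {F : holomorphicFunctions}
    (hF : F ∈ modularGrade n) : monomial n F ∈ eisensteinSubalgebra := by
  induction n using Nat.strong_induction_on generalizing F with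
  | _ n ih =>
  obtain rfl | rfl | ⟨a, b, hn⟩ : n = 0 ∨ n = 1 ∨ ∃ a b, n = 2 * a + 3 * b := by
    obtain h | h : n < 2 ∨ 2 ≤ n := lt_or_ge n 2
    · lia
    · exact .inr (.inr ⟨n / 2 - n % 2, n % 2, by lia⟩)
  · exact monomial_zero_mem_eisensteinSubalgebra hF
  · rw [modularGrade_one, Submodule.mem_bot] at hF
    rw [hF, map_zero]
    exact zero_mem _
  obtain ⟨f, rfl⟩ := hF
  obtain ⟨c, g, hg⟩ := exists_toHolomorphic_eq_add (a := a) (b := b) (by rw [hn]; push_cast; ring) f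
  rw [hg, map_add, ← smul_monomial, ← smul_monomial]
  refine add_mem (Subalgebra.smul_mem _ ?_ c) (Subalgebra.smul_mem _ ?_ _)
  · exact hn ▸ monomial_E₄_pow_mul_E₆_pow_mem_eisensteinSubalgebra a b
  obtain hn6 | hn6 := lt_or_ge n 6
  · have : toHolomorphic _ g = 0 :=
      Subtype.ext (ModularFormClass.levelOne_neg_weight_eq_zero (by lia) g)
    rw [this, mul_zero, map_zero]
    exact zero_mem _
  · obtain ⟨m, rfl⟩ := Nat.exists_eq_add_of_le hn6
    rw [← monomial_mul_monomial]
    exact mul_mem monomial_E₄_cube_sub_E₆_sq_mem_eisensteinSubalgebra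
      (ih m (by lia) (toHolomorphic_mem_modularGrade (by push_cast; ring) g))

lemma gradedSubalgebra_modularGrade : gradedSubalgebra modularGrade = eisensteinSubalgebra := by
  refine le_antisymm (fun p hp ↦ ?_) (Algebra.adjoin_le ?_)
  · rw [p.as_sum_range]
    exact sum_mem fun i _ ↦ monomial_mem_eisensteinSubalgebra (hp i)
  · rintro _ (rfl | rfl)
    · exact monomial_mem_gradedSubalgebra (toHolomorphic_mem_modularGrade (n := 2) rfl E₄)
    · exact monomial_mem_gradedSubalgebra (toHolomorphic_mem_modularGrade (n := 3) rfl E₆)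

instance : IsNoetherianRing (gradedSubalgebra modularGrade) := by
  have : Algebra.FiniteType ℂ (gradedSubalgebra modularGrade) := by
    rw [← Subalgebra.fg_iff_finiteType, gradedSubalgebra_modularGrade]
    exact Subalgebra.fg_def.mpr ⟨_, Set.toFinite _, rfl⟩
  exact Algebra.FiniteType.isNoetherianRing ℂ _

end HolomorphicFunctions

section MonicSol

open EisensteinSeries Derivative

lemma coe_twistedIterate (k : ℝ) (F : holomorphicFunctions) (n : ℕ) :
    ((twistedIterate holomorphicDeriv serreConnection (k : ℂ) F n : holomorphicFunctions) : ℍ → ℂ) =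
      srDiff k F n := by
  induction n with
  | zero => rfl
  | succ n ih =>
    rw [twistedIterate, srDiff, coe_twistedDeriv, ih]
    push_cast
    rfl

lemma mem_monicSol_iff {k : ℝ} {F : holomorphicFunctions} : (F : ℍ → ℂ) ∈ monicSol k ↔
    SatisfiesMonicEquation modularGrade holomorphicDeriv serreConnection (k : ℂ) F := by
  have coe_sum (n : ℕ) (g : ℕ → holomorphicFunctions) (z : ℍ) :
      (∑ i ∈ Finset.range (n + 1),
        g i * twistedIterate holomorphicDeriv serreConnection (k : ℂ) F (n - i)).1 z =
      ∑ i ∈ Finset.range (n + 1), (g i).1 z * srDiff k F (n - i) z := by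
    simp [← coe_twistedIterate]
  constructor
  · rintro ⟨-, n, g, hg0, h⟩
    refine ⟨n, fun i ↦ toHolomorphic _ (g i), fun i ↦ ⟨g i, rfl⟩, Subtype.ext (funext hg0),
      Subtype.ext (funext fun z ↦ ?_)⟩
    exact (coe_sum n _ z).trans (h z)
  · rintro ⟨n, g, hg, hg0, h⟩
    choose G hG using hg
    obtain rfl : (fun i ↦ toHolomorphic _ (G i)) = g := funext hG
    refine ⟨F.2, n, G, fun z ↦ congrFun (congrArg Subtype.val hg0) z, fun z ↦ ?_⟩
    exact (coe_sum n _ z).symm.trans (congrFun (congrArg Subtype.val h) z)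

variable {k l : ℝ} {f g : ℍ → ℂ}

lemma add_mem_monicSol (hf : f ∈ monicSol k) (hg : g ∈ monicSol k) : f + g ∈ monicSol k := by
  lift f to holomorphicFunctions using hf.1
  lift g to holomorphicFunctions using hg.1
  exact mem_monicSol_iff.mpr <|
    (mem_monicSol_iff.mp hf).add twistedDeriv_mem_modularGrade (mem_monicSol_iff.mp hg)

lemma mul_mem_monicSol (hf : f ∈ monicSol k) (hg : g ∈ monicSol l) :
    f * g ∈ monicSol (k + l) := by
  lift f to holomorphicFunctions using hf.1
  lift g to holomorphicFunctions using hg.1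
  rw [← MulMemClass.coe_mul, mem_monicSol_iff, Complex.ofReal_add]
  exact (mem_monicSol_iff.mp hf).mul twistedDeriv_mem_modularGrade (mem_monicSol_iff.mp hg)

lemma mem_monicSol_neg_one_of_normalizedDeriv_eq_const (hf : MDiff f) {c : ℂ}
    (hc : ∀ z, normalizedDerivOfComplex f z = c) : f ∈ monicSol (-1) := by
  lift f to holomorphicFunctions using hf
  have deriv_eq : holomorphicDeriv f = algebraMap ℂ holomorphicFunctions c :=
    Subtype.ext (funext hc)
  rw [mem_monicSol_iff, Complex.ofReal_neg, Complex.ofReal_one]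
  exact satisfiesMonicEquation_neg_one twistedDeriv_serreConnection_mem_modularGrade deriv_eq

lemma one_mem_monicSol : (1 : ℍ → ℂ) ∈ monicSol (-1) :=
  mem_monicSol_neg_one_of_normalizedDeriv_eq_const (c := 0) mdifferentiable_const fun z ↦ by
    simp [normalizedDerivOfComplex, Function.comp_def]

lemma normalizedDerivOfComplex_logQ (z : ℍ) : normalizedDerivOfComplex logQ z = 1 := by
  have hderiv : HasDerivAt (logQ ∘ ofComplex) (2 * (Real.pi : ℂ) * Complex.I * 1) (z : ℂ) := by
    refine ((hasDerivAt_id (z : ℂ)).const_mul _).congr_of_eventuallyEq ?_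
    filter_upwards [isOpen_upperHalfPlaneSet.mem_nhds z.im_pos] with w hw
    simp [logQ, ofComplex_apply_of_im_pos hw]
  rw [normalizedDerivOfComplex, hderiv.deriv, mul_one, inv_mul_cancel₀ (by simp [Real.pi_ne_zero])]

lemma logQ_mem_monicSol : logQ ∈ monicSol (-1) :=
  mem_monicSol_neg_one_of_normalizedDeriv_eq_const (mdifferentiable_const.mul mdifferentiable_coe)
    normalizedDerivOfComplex_logQ

lemma E2_mem_monicSol : E2 ∈ monicSol 1 := by
  have eq_smul : E2 = ((12 : ℂ) • serreConnection : holomorphicFunctions) := by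
    ext z
    simp [serreConnection]
  rw [eq_smul, mem_monicSol_iff, Complex.ofReal_one]
  exact satisfiesMonicEquation_smul_connection twistedDeriv_mem_modularGrade
    twistedDeriv_serreConnection_mem_modularGrade 12

lemma monicSol_subset_sub_one (k : ℝ) : monicSol k ⊆ monicSol (k - 1) := fun f hf ↦ by
  rw [← mul_one f]
  exact mul_mem_monicSol hf one_mem_monicSol

lemma monicSol_subset_sub_nat (k : ℝ) (n : ℕ) : monicSol k ⊆ monicSol (k - n) := by
  induction n with
  | zero => simp
  | succ n ih =>
    rw [Nat.cast_succ, ← sub_sub]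
    exact ih.trans (monicSol_subset_sub_one _)

lemma monicSol_subset_of_le (hlk : l ≤ k) {m : ℤ} (hm : k - l = m) :
    monicSol k ⊆ monicSol l := by
  have hm0 : 0 ≤ m := by
    rw [← Int.cast_nonneg_iff (R := ℝ), ← hm]
    exact sub_nonneg.mpr hlk
  lift m to ℕ using hm0
  rw [Int.cast_natCast] at hm
  rw [← sub_sub_cancel k l, hm]
  exact monicSol_subset_sub_nat k m

end MonicSol

theorem mainTheorem7 :
    (∀ k : ℝ, monicSol k ⊆ monicSol (k - 1)) ∧
    (∀ k : ℝ, (fun f : ℍ → ℂ => logQ * f) '' monicSol k ⊆ monicSol (k - 1)) ∧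
    (∀ k : ℝ, (fun f : ℍ → ℂ => EisensteinSeries.E2 * f) '' monicSol k ⊆ monicSol (k + 1)) ∧
    (∀ k l : ℝ, (∃ m : ℤ, k - l = (m : ℝ)) →
      monicSol k + monicSol l ⊆ monicSol (min k l)) := by
  refine ⟨monicSol_subset_sub_one, ?_, ?_, ?_⟩
  · rintro k _ ⟨f, hf, rfl⟩
    rw [sub_eq_neg_add]
    exact mul_mem_monicSol logQ_mem_monicSol hf
  · rintro k _ ⟨f, hf, rfl⟩
    rw [add_comm]
    exact mul_mem_monicSol E2_mem_monicSol hf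
  · rintro k l ⟨m, hm⟩ _ ⟨f, hf, g, hg, rfl⟩
    rcases le_total k l with hkl | hlk
    · rw [min_eq_left hkl]
      exact add_mem_monicSol hf (monicSol_subset_of_le (m := -m) hkl (by push_cast; linarith) hg)
    · rw [min_eq_right hlk]
      exact add_mem_monicSol (monicSol_subset_of_le hlk hm hf) hg
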